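/- Consider two agents in the plane with relative position $\xi$ and relative velocity $v$, $$\dot\xi = v,\qquad \dot v = u_1-u_2,\qquad \xi,v,u_1,u_2\in\mathbb R^2 .$$ Let $r>0$ and $h(\xi)=\xi^T\xi-r^2$, and let $l_0,l_1>0$ with $l_1^2\ge 4l_0$, so that both roots of $s^2+l_1s+l_0$ are real and negative; let $\lambda$ be one of these roots. Put $a=2v^Tv+2l_1\xi^Tv+l_0(\xi^T\xi-r^2)$ and $b=2\xi^T$, so that $\ddot h+l_1\dot h+l_0h=a+b(u_1-u_2)$, and let $$\mathcal C^*=\{(\xi,v): h(\xi)\ge 0,\ h(\xi)\ge \tfrac1\lambda\,\dot h(\xi,v)\},\qquad \dot h(\xi,v)=2\xi^Tv .$$ Agent 1 has a base action $u_{01}$ and runs the PCCA controller with sampling time $\Delta t>0$, zero-order hold and unit delay: with $t_k=t_0+k\Delta t$ and all quantities with argument $k$ evaluated at $t_k$, $$u_{11}^*(k)=u_{01}(k)-\min\{0,\mu_1(k)\}\frac{b(k)^T}{2b(k)b(k)^T},\qquad u_{12}^*(k)=\min\{0,\mu_1(k)\}\frac{b(k)^T}{2b(k)b(k)^T},$$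 $$\mu_1(k)=a(k)+b(k)u_{01}(k)-b(k)\hat w_2(k),\qquad \hat w_2(k+1)=u_2(k)-u_{12}^*(k),$$ where $\hat w_2(0)$ is an arbitrary initial value, and $u_1(t)=u_{11}^*(k)$ for $t\in[t_k,t_{k+1})$. Agent 2 is non-interacting: it applies $u_2(t)=u_{02}(t)$ for all $t$. Then for all $T>t_0$ and all constants $U,M,R$ there exist $\Delta t^*>0$ and $\kappa>0$, depending only on $r,l_0,l_1,\lambda,t_0,T,U,M,R$, such that for every sampling time $0<\Delta t<\Delta t^*$ the following holds. Suppose that on $[t_0,T]$ the base action $u_{01}$ is bounded by $U$, and $u_{02}$ is bounded by $U$ and differentiable with derivative bounded by $M$. Then every solution $(\xi,v)$ of the closed-loop system on $[t_0,T]$ with $(\xi(t_0),v(t_0))\in\mathcal C^*$ and $\|\xi(t_0)\|,\|v(t_0)\|,\|\hat w_2(0)\|\le R$ satisfies $$h(\xi(t))\ \ge\ -\kappa\,\Delta t\qquad\text{for all } t\in[t_0,T],$$ that is, $h(\xi(t))\ge\mathcal O(\Delta t)$ on $[t_0,T]$. -/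

import Mathlib

open Set

namespace PCCA

noncomputable section

/-- The plane with its Euclidean norm. -/
abbrev Plane : Type := EuclideanSpace ℝ (Fin 2)

/-- Barrier function `h(ξ) = ξᵀξ - r²`. -/
def h (r : ℝ) (ξ : Plane) : ℝ := inner ℝ ξ ξ - r ^ 2

/-- Derivative of `h` along `ξ' = v`, namely `2 ξᵀv`. -/
def hdot (ξ v : Plane) : ℝ := 2 * inner ℝ ξ v

/-- `a = 2 vᵀv + 2 l₁ ξᵀv + l₀ (ξᵀξ - r²)`. -/
def a (l₀ l₁ r : ℝ) (ξ v : Plane) : ℝ :=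
  2 * inner ℝ v v + 2 * l₁ * inner ℝ ξ v + l₀ * (inner ℝ ξ ξ - r ^ 2)

/-- The vector `bᵀ`, where `b = 2 ξᵀ`; hence `b w` is `inner ℝ (bT ξ) w`. -/
def bT (ξ : Plane) : Plane := (2 : ℝ) • ξ

/-- The reduced admissible set `C* = {(ξ, v) : h ≥ 0, h ≥ hdot / root}`. -/
def admissible (r root : ℝ) : Set (Plane × Plane) :=
  {p | 0 ≤ h r p.1 ∧ hdot p.1 p.2 / root ≤ h r p.1}

/-- `μ₁ = a + b u₀₁ - b ŵ₂`. -/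
def mu1 (l₀ l₁ r : ℝ) (ξ v u01 w2 : Plane) : ℝ :=
  a l₀ l₁ r ξ v + inner ℝ (bT ξ) u01 - inner ℝ (bT ξ) w2

/-- `u₁₁* = u₀₁ - min{0, μ₁} bᵀ / (2 b bᵀ)`, the action that agent 1 applies. -/
def u11star (l₀ l₁ r : ℝ) (ξ v u01 w2 : Plane) : Plane :=
  u01 + (-min 0 (mu1 l₀ l₁ r ξ v u01 w2) / (2 * inner ℝ (bT ξ) (bT ξ))) • bT ξ

/-- `u₁₂* = min{0, μ₁} bᵀ / (2 b bᵀ)`, the action that agent 1 expects of agent 2. -/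
def u12star (l₀ l₁ r : ℝ) (ξ v u01 w2 : Plane) : Plane :=
  (min 0 (mu1 l₀ l₁ r ξ v u01 w2) / (2 * inner ℝ (bT ξ) (bT ξ))) • bT ξ

/-- The sampling instants `t_k = t₀ + k Δt`. -/
def sampleTime (t₀ Δt : ℝ) (k : ℕ) : ℝ := t₀ + k * Δt

/-- The disturbance estimate of agent 1, updated with one sample of delay:
`ŵ₂(0) = w₀` and `ŵ₂(k+1) = u₂(k) - u₁₂*(k)`. -/
def w2hat (l₀ l₁ r t₀ Δt : ℝ) (u01 u2 ξ v : ℝ → Plane) (w₀ : Plane) : ℕ → Plane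
  | 0 => w₀
  | k + 1 => u2 (sampleTime t₀ Δt k) -
      u12star l₀ l₁ r (ξ (sampleTime t₀ Δt k)) (v (sampleTime t₀ Δt k))
        (u01 (sampleTime t₀ Δt k)) (w2hat l₀ l₁ r t₀ Δt u01 u2 ξ v w₀ k)

/-- The control of agent 1 in continuous time (zero-order hold): on `[t_k, t_{k+1})` it is
the value `u₁₁*(k)` computed from the data at `t_k`. -/
def u1 (l₀ l₁ r t₀ Δt : ℝ) (u01 u2 ξ v : ℝ → Plane) (w₀ : Plane) (t : ℝ) : Plane :=
  let k : ℕ := ⌊(t - t₀) / Δt⌋₊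
  let tk : ℝ := sampleTime t₀ Δt k
  u11star l₀ l₁ r (ξ tk) (v tk) (u01 tk) (w2hat l₀ l₁ r t₀ Δt u01 u2 ξ v w₀ k)

/-- `(ξ, v)` is a solution on `[t₀, T]` of `ξ' = v`, `v' = u₁ - u₂`, where `u₁` is the sampled
controller of agent 1. The input `u₁` jumps at the sampling instants, so the equations hold for
the continuous functions `ξ`, `v` with right derivatives. -/
structure IsClosedLoopSolution (l₀ l₁ r t₀ T Δt : ℝ) (u01 u2 : ℝ → Plane) (w₀ : Plane)
    (ξ v : ℝ → Plane) : Prop where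
  continuousOn_pos : ContinuousOn ξ (Icc t₀ T)
  continuousOn_vel : ContinuousOn v (Icc t₀ T)
  deriv_pos : ∀ t ∈ Ico t₀ T, HasDerivWithinAt ξ (v t) (Ici t) t
  deriv_vel : ∀ t ∈ Ico t₀ T,
    HasDerivWithinAt v (u1 l₀ l₁ r t₀ Δt u01 u2 ξ v w₀ t - u2 t) (Ici t) t

end

end PCCA

/-!
Write `m k = min 0 (μ₁ k)`. The action that agent 1 expects of agent 2 satisfies
`2 b u₁₂* = m`, so at a sampling instant the barrier expression `a + b (u₁ - u₂)` is at least
`(m k - 2 b (u₂ - ŵ₂)) / 2`, and the delayed estimate gives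
`2 b (u₂ - ŵ₂) = m (k - 1) + O(Δt)`. Agent 2 does not contribute its share, yet the resulting
deficit `(m k - m (k - 1)) / 2` telescopes: its integral over time is the piecewise linear
`corrector`, which is `O(Δt)` because `m` is bounded.

With the second root `root' = -l₁ - root`, the function `z = hdot - root * h` satisfies
`z' = root' * z + (a + b (u₁ - u₂))`. Subtracting the corrector from `z` leaves a function whose
derivative is positive on a level `-c Δt` (`IsDistantRun.innerBarrier`), so `z ≥ -c' Δt`. Then
`h' = root * h + z` is positive on the level `h = -κ Δt`
(`IsDistantRun.neg_safetyLevel_le_h`). Both roots are negative, so constant barriers suffice and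
no integration is needed.

The constants require a bound on all signals that is uniform in `Δt`
(`exists_signalsBounded`). While the distance is at least `r / 2`, the action `u₁₂*` grows at
most linearly in the speed, as the quadratic term of `a` has the favourable sign, and the
estimate `ŵ₂` is fed back with gain `1/2`; an induction over the sampling intervals then gives an
exponential bound for the speed. The assumption on the distance is removed by looking at the
first time at which the distance equals `r / 2`: there `h = -3 r² / 4`, which contradicts
`h ≥ -κ Δt` for `Δt < r² / (2 κ)`.
-/

open Set

namespace PCCA

/-! ### Barriers and elementary estimates -/

/-- A function cannot fall below a level at which its right derivative is positive. -/
theorem le_of_deriv_pos_at_barrier {f f' : ℝ → ℝ} {s e c : ℝ} (hf : ContinuousOn f (Icc s e))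
    (hf' : ∀ x ∈ Ico s e, HasDerivWithinAt f (f' x) (Ici x) x) (hs : c ≤ f s)
    (hpos : ∀ x ∈ Ico s e, f x = c → 0 < f' x) : ∀ x ∈ Icc s e, c ≤ f x := by
  intro x hx
  have := image_le_of_deriv_right_lt_deriv_boundary' (f := fun x => -f x) (f' := fun x => -f' x)
    (B := fun _ => -c) (B' := fun _ => 0) (a := s) (b := e) hf.neg
    (fun x hx => (hf' x hx).neg) (by simpa using hs) continuousOn_const
    (fun x _ => hasDerivWithinAt_const _ _ _)
    (fun x hx h => by simpa using hpos x hx (by simpa using h)) hx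
  simpa using this

theorem abs_inner_sub_inner_le (x y x' y' : Plane) :
    |inner ℝ x y - inner ℝ x' y'| ≤ ‖x - x'‖ * ‖y‖ + ‖x'‖ * ‖y - y'‖ := by
  have e : inner ℝ x y - inner ℝ x' y' = inner ℝ (x - x') y + inner ℝ x' (y - y') := by
    rw [inner_sub_left, inner_sub_right]; ring
  rw [e]
  exact (abs_add_le _ _).trans
    (add_le_add (abs_real_inner_le_norm _ _) (abs_real_inner_le_norm _ _))

theorem roots_neg {l₀ l₁ root : ℝ} (hl₀ : 0 < l₀) (hl₁ : 0 < l₁)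
    (hroot : root ^ 2 + l₁ * root + l₀ = 0) : root < 0 ∧ -l₁ - root < 0 := by
  have h1 : root < 0 := by
    by_contra hc
    have : 0 ≤ root := not_lt.mp hc
    nlinarith [mul_nonneg hl₁.le this, sq_nonneg root]
  refine ⟨h1, ?_⟩
  by_contra hc
  have : 0 ≤ -l₁ - root := not_lt.mp hc
  nlinarith [mul_nonneg this (neg_nonneg.mpr h1.le)]

/-! ### The controller at one sampling instant -/

theorem norm_bT (ξ : Plane) : ‖bT ξ‖ = 2 * ‖ξ‖ := by
  simp [bT, norm_smul]

theorem u11star_eq_sub (l₀ l₁ r : ℝ) (ξ v u01 w2 : Plane) :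
    u11star l₀ l₁ r ξ v u01 w2 = u01 - u12star l₀ l₁ r ξ v u01 w2 := by
  rw [u11star, u12star, neg_div, neg_smul, sub_eq_add_neg]

theorem two_mul_inner_u12star (l₀ l₁ r : ℝ) {ξ : Plane} (v u01 w2 : Plane) (hξ : ξ ≠ 0) :
    2 * inner ℝ (bT ξ) (u12star l₀ l₁ r ξ v u01 w2) = min 0 (mu1 l₀ l₁ r ξ v u01 w2) := by
  have : inner ℝ (bT ξ) (bT ξ) ≠ 0 := by
    simpa [bT] using hξ
  rw [u12star, inner_smul_right]
  field_simp

/-- Because `a` contains the nonnegative term `2 vᵀv`, its negative part grows only linearly in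
`v`. This is what excludes a finite escape time. The factor `1/2` in front of `‖w2‖` makes the
delayed feedback of the estimate a contraction. -/
theorem norm_u12star_le {l₀ l₁ r : ℝ} (hr : 0 < r) (hl₀ : 0 < l₀) (hl₁ : 0 < l₁) {ξ : Plane}
    (v u01 w2 : Plane) (hξ : r / 2 ≤ ‖ξ‖) :
    ‖u12star l₀ l₁ r ξ v u01 w2‖ ≤ (l₁ * ‖v‖ + l₀ * r + ‖u01‖ + ‖w2‖) / 2 := by
  have hn : 0 < ‖ξ‖ := by linarith
  set m := mu1 l₀ l₁ r ξ v u01 w2 with hm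
  have e : ‖u12star l₀ l₁ r ξ v u01 w2‖ = -min 0 m / (4 * ‖ξ‖) := by
    rw [u12star, norm_smul, real_inner_self_eq_norm_sq, norm_bT, ← hm, Real.norm_eq_abs, abs_div,
      abs_of_nonpos (min_le_left _ _), abs_of_pos (by positivity)]
    field_simp
    norm_num
  rw [e, div_le_iff₀ (by positivity)]
  have h1 := abs_le.mp (abs_real_inner_le_norm ξ v)
  have h2 := abs_le.mp (abs_real_inner_le_norm (bT ξ) u01)
  have h3 := abs_le.mp (abs_real_inner_le_norm (bT ξ) w2)
  rw [norm_bT] at h2 h3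
  have h4 : 0 ≤ inner ℝ v v := real_inner_self_nonneg
  have h5 : 0 ≤ l₀ * inner ℝ ξ ξ := mul_nonneg hl₀.le real_inner_self_nonneg
  have h6 : -(l₁ * (‖ξ‖ * ‖v‖)) ≤ l₁ * inner ℝ ξ v := by
    rw [← mul_neg]; exact mul_le_mul_of_nonneg_left h1.1 hl₁.le
  have h7 : l₀ * r ^ 2 ≤ l₀ * r * (2 * ‖ξ‖) := by
    rw [pow_two, ← mul_assoc]
    exact mul_le_mul_of_nonneg_left (by linarith) (by positivity)
  have hb : -m ≤ (l₁ * ‖v‖ + l₀ * r + ‖u01‖ + ‖w2‖) / 2 * (4 * ‖ξ‖) := by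
    rw [hm, mu1, a]
    nlinarith
  rcases min_cases 0 m with h | h
  · rw [h.1, neg_zero]; positivity
  · rw [h.1]; exact hb

/-- At a sampling instant the second-order barrier expression falls short of zero by at most
half of the difference between the current value of `min 0 μ₁` and the quantity
`2 b (u₂ - ŵ₂)`, which up to the sampling error is the previous value of `min 0 μ₁`. -/
theorem half_sub_le_barrier_expr (l₀ l₁ r : ℝ) {ξ : Plane} (v u01 u2 w2 : Plane) (hξ : ξ ≠ 0) :
    (2 * inner ℝ (bT ξ) (u12star l₀ l₁ r ξ v u01 w2) - 2 * inner ℝ (bT ξ) (u2 - w2)) / 2 ≤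
      a l₀ l₁ r ξ v + inner ℝ (bT ξ) (u11star l₀ l₁ r ξ v u01 w2 - u2) := by
  have e := two_mul_inner_u12star l₀ l₁ r v u01 w2 hξ
  have hm := min_le_right 0 (mu1 l₀ l₁ r ξ v u01 w2)
  have hd : mu1 l₀ l₁ r ξ v u01 w2 =
    a l₀ l₁ r ξ v + inner ℝ (bT ξ) u01 - inner ℝ (bT ξ) w2 := rfl
  rw [u11star_eq_sub]
  simp only [inner_sub_right]
  linarith

/-! ### Runs that keep away from the origin -/

/-- The action `u₁₂*(k)` that agent 1 expects of agent 2 at the sampling instant `t_k`. -/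
noncomputable def expectedAction (l₀ l₁ r t₀ Δt : ℝ) (u01 u2 ξ v : ℝ → Plane) (w₀ : Plane)
    (k : ℕ) : Plane :=
  u12star l₀ l₁ r (ξ (sampleTime t₀ Δt k)) (v (sampleTime t₀ Δt k))
    (u01 (sampleTime t₀ Δt k)) (w2hat l₀ l₁ r t₀ Δt u01 u2 ξ v w₀ k)

/-- The action `u₁₁*(k)` that agent 1 holds on `[t_k, t_{k+1})`. -/
noncomputable def heldAction (l₀ l₁ r t₀ Δt : ℝ) (u01 u2 ξ v : ℝ → Plane) (w₀ : Plane)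
    (k : ℕ) : Plane :=
  u11star l₀ l₁ r (ξ (sampleTime t₀ Δt k)) (v (sampleTime t₀ Δt k))
    (u01 (sampleTime t₀ Δt k)) (w2hat l₀ l₁ r t₀ Δt u01 u2 ξ v w₀ k)

/-- A solution of the closed loop on `[t₀, τ]` with bounded data, a Lipschitz action of agent 2,
and distance at least `r / 2` between the agents. -/
structure IsDistantRun (l₀ l₁ r t₀ τ Δt U M R : ℝ) (u01 u2 : ℝ → Plane) (w₀ : Plane)
    (ξ v : ℝ → Plane) : Prop extends
    IsClosedLoopSolution l₀ l₁ r t₀ τ Δt u01 u2 w₀ ξ v where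
  base_le : ∀ t ∈ Icc t₀ τ, ‖u01 t‖ ≤ U
  other_le : ∀ t ∈ Icc t₀ τ, ‖u2 t‖ ≤ U
  other_lip : ∀ s ∈ Icc t₀ τ, ∀ t ∈ Icc t₀ τ, ‖u2 t - u2 s‖ ≤ M * ‖t - s‖
  pos_init : ‖ξ t₀‖ ≤ R
  vel_init : ‖v t₀‖ ≤ R
  est_init : ‖w₀‖ ≤ R
  distant : ∀ t ∈ Icc t₀ τ, r / 2 ≤ ‖ξ t‖

theorem sampleTime_zero (t₀ Δt : ℝ) : sampleTime t₀ Δt 0 = t₀ := by simp [sampleTime]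

theorem sampleTime_succ (t₀ Δt : ℝ) (k : ℕ) :
    sampleTime t₀ Δt (k + 1) = sampleTime t₀ Δt k + Δt := by
  simp only [sampleTime]; push_cast; ring

theorem le_sampleTime {t₀ Δt : ℝ} (hΔ : 0 < Δt) (k : ℕ) : t₀ ≤ sampleTime t₀ Δt k := by
  have : 0 ≤ (k : ℝ) * Δt := by positivity
  simp only [sampleTime]; linarith

theorem exists_sampleTime_le {t₀ Δt t : ℝ} (hΔ : 0 < Δt) (ht : t₀ ≤ t) :
    ∃ k, sampleTime t₀ Δt k ≤ t ∧ t < sampleTime t₀ Δt (k + 1) := by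
  have h0 : 0 ≤ (t - t₀) / Δt := div_nonneg (by linarith) hΔ.le
  refine ⟨⌊(t - t₀) / Δt⌋₊, ?_, ?_⟩
  · have := (le_div_iff₀ hΔ).mp (Nat.floor_le h0)
    simp only [sampleTime]; linarith
  · have := (div_lt_iff₀ hΔ).mp (Nat.lt_floor_add_one ((t - t₀) / Δt))
    simp only [sampleTime]; push_cast; linarith

theorem u1_eq_heldAction {l₀ l₁ r t₀ Δt t : ℝ} {u01 u2 ξ v : ℝ → Plane} {w₀ : Plane} {k : ℕ}
    (hΔ : 0 < Δt) (h1 : sampleTime t₀ Δt k ≤ t) (h2 : t < sampleTime t₀ Δt (k + 1)) :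
    u1 l₀ l₁ r t₀ Δt u01 u2 ξ v w₀ t = heldAction l₀ l₁ r t₀ Δt u01 u2 ξ v w₀ k := by
  have ht := (le_sampleTime hΔ k).trans h1
  have hk : ⌊(t - t₀) / Δt⌋₊ = k := by
    rw [Nat.floor_eq_iff (div_nonneg (by linarith) hΔ.le), le_div_iff₀ hΔ, div_lt_iff₀ hΔ]
    simp only [sampleTime] at h1 h2
    push_cast at h2
    constructor <;> linarith
  simp only [u1, heldAction, hk]

section Bounds

variable {l₀ l₁ r t₀ τ Δt U M R : ℝ} {u01 u2 ξ v : ℝ → Plane} {w₀ : Plane}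

theorem sampleTime_mem_Icc (hΔ : 0 < Δt) {k : ℕ} (hk : sampleTime t₀ Δt k ≤ τ) :
    sampleTime t₀ Δt k ∈ Icc t₀ τ := ⟨le_sampleTime hΔ k, hk⟩

theorem IsDistantRun.hasDerivWithinAt_vel
    (H : IsDistantRun l₀ l₁ r t₀ τ Δt U M R u01 u2 w₀ ξ v) (hΔ : 0 < Δt) {k : ℕ} {t : ℝ}
    (h1 : sampleTime t₀ Δt k ≤ t) (h2 : t < sampleTime t₀ Δt (k + 1)) (h3 : t < τ) :
    HasDerivWithinAt v (heldAction l₀ l₁ r t₀ Δt u01 u2 ξ v w₀ k - u2 t) (Ici t) t := by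
  rw [← u1_eq_heldAction hΔ h1 h2]
  exact H.deriv_vel t ⟨(le_sampleTime hΔ k).trans h1, h3⟩

theorem IsDistantRun.norm_expectedAction_le
    (H : IsDistantRun l₀ l₁ r t₀ τ Δt U M R u01 u2 w₀ ξ v) (hr : 0 < r) (hl₀ : 0 < l₀)
    (hl₁ : 0 < l₁) (hΔ : 0 < Δt) {k : ℕ} (hk : sampleTime t₀ Δt k ≤ τ) :
    ‖expectedAction l₀ l₁ r t₀ Δt u01 u2 ξ v w₀ k‖ ≤
      (l₁ * ‖v (sampleTime t₀ Δt k)‖ + l₀ * r + U +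
        ‖w2hat l₀ l₁ r t₀ Δt u01 u2 ξ v w₀ k‖) / 2 := by
  have hm := sampleTime_mem_Icc hΔ hk
  have h1 := norm_u12star_le hr hl₀ hl₁ (v (sampleTime t₀ Δt k)) (u01 (sampleTime t₀ Δt k))
    (w2hat l₀ l₁ r t₀ Δt u01 u2 ξ v w₀ k) (H.distant _ hm)
  have h2 := H.base_le _ hm
  exact h1.trans (by linarith)

theorem IsDistantRun.norm_heldAction_le
    (H : IsDistantRun l₀ l₁ r t₀ τ Δt U M R u01 u2 w₀ ξ v) (hΔ : 0 < Δt) {k : ℕ}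
    (hk : sampleTime t₀ Δt k ≤ τ) :
    ‖heldAction l₀ l₁ r t₀ Δt u01 u2 ξ v w₀ k‖ ≤
      U + ‖expectedAction l₀ l₁ r t₀ Δt u01 u2 ξ v w₀ k‖ := by
  rw [heldAction, u11star_eq_sub]
  exact (norm_sub_le _ _).trans
    (add_le_add (H.base_le _ (sampleTime_mem_Icc hΔ hk)) le_rfl)

/-- The exponential majorant of the speed. The rate `l₁ + 1` absorbs both the gain `l₁` of the
controller and the constant part of the acceleration. -/
noncomputable def speedBound (l₀ l₁ r t₀ U R t : ℝ) : ℝ :=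
  (l₀ * r + 5 * U + 2 * R) * Real.exp ((l₁ + 1) * (t - t₀))

theorem speedBound_mono (hr : 0 < r) (hl₀ : 0 < l₀) (hl₁ : 0 < l₁) (hU : 0 ≤ U) (hR : 0 ≤ R) :
    Monotone (speedBound l₀ l₁ r t₀ U R) := by
  intro s t hst
  unfold speedBound
  gcongr

theorem le_speedBound (hr : 0 < r) (hl₀ : 0 < l₀) (hl₁ : 0 < l₁) (hU : 0 ≤ U) (hR : 0 ≤ R)
    {t : ℝ} (ht : t₀ ≤ t) : l₀ * r + 5 * U + 2 * R ≤ speedBound l₀ l₁ r t₀ U R t := by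
  have := speedBound_mono (t₀ := t₀) hr hl₀ hl₁ hU hR ht
  simpa [speedBound] using this

theorem hasDerivAt_speedBound (t : ℝ) :
    HasDerivAt (speedBound l₀ l₁ r t₀ U R) ((l₁ + 1) * speedBound l₀ l₁ r t₀ U R t) t := by
  have h1 : HasDerivAt (fun t => (l₁ + 1) * (t - t₀)) ((l₁ + 1) * 1) t :=
    ((hasDerivAt_id t).sub_const t₀).const_mul _
  have := h1.exp.const_mul (l₀ * r + 5 * U + 2 * R)
  refine this.congr_deriv ?_
  rw [speedBound]
  ring

/-- If the estimate and the speed respect their bounds at `t_k`, then the speed bound propagates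
through the holding interval. -/
theorem IsDistantRun.norm_vel_le_step
    (H : IsDistantRun l₀ l₁ r t₀ τ Δt U M R u01 u2 w₀ ξ v) (hr : 0 < r) (hl₀ : 0 < l₀)
    (hl₁ : 0 < l₁) (hΔ : 0 < Δt) (hU : 0 ≤ U) (hR : 0 ≤ R) {k : ℕ}
    (hv : ‖v (sampleTime t₀ Δt k)‖ ≤ speedBound l₀ l₁ r t₀ U R (sampleTime t₀ Δt k))
    (hw : ‖w2hat l₀ l₁ r t₀ Δt u01 u2 ξ v w₀ k‖ ≤
      l₀ * r + 3 * U + R + l₁ * speedBound l₀ l₁ r t₀ U R (sampleTime t₀ Δt k))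
    {t : ℝ} (h1 : sampleTime t₀ Δt k ≤ t) (h2 : t ≤ sampleTime t₀ Δt (k + 1)) (h3 : t ≤ τ) :
    ‖v t‖ ≤ speedBound l₀ l₁ r t₀ U R t := by
  have hk0 := le_sampleTime (t₀ := t₀) hΔ k
  have hkτ := h1.trans h3
  refine image_norm_le_of_norm_deriv_right_le_deriv_boundary
    (f := v) (f' := fun s => heldAction l₀ l₁ r t₀ Δt u01 u2 ξ v w₀ k - u2 s)
    (B := speedBound l₀ l₁ r t₀ U R) (B' := fun s => (l₁ + 1) * speedBound l₀ l₁ r t₀ U R s)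
    (a := sampleTime t₀ Δt k) (b := t)
    (H.continuousOn_vel.mono (Icc_subset_Icc hk0 h3)) ?_ hv
    hasDerivAt_speedBound ?_ ⟨h1, le_rfl⟩
  · intro s hs
    exact H.hasDerivWithinAt_vel hΔ hs.1 (hs.2.trans_le h2) (hs.2.trans_le h3)
  · intro s hs
    have g1 := H.norm_expectedAction_le hr hl₀ hl₁ hΔ hkτ
    have g2 := H.norm_heldAction_le hΔ hkτ
    have g3 := H.other_le s ⟨hk0.trans hs.1, hs.2.le.trans h3⟩
    have g4 := speedBound_mono (t₀ := t₀) hr hl₀ hl₁ hU hR hs.1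
    have g5 := le_speedBound hr hl₀ hl₁ hU hR (hk0.trans hs.1)
    have g6 := mul_le_mul_of_nonneg_left hv hl₁.le
    have g7 := mul_le_mul_of_nonneg_left g4 hl₁.le
    have g8 := norm_sub_le (heldAction l₀ l₁ r t₀ Δt u01 u2 ξ v w₀ k) (u2 s)
    have g9 : 0 < l₀ * r := by positivity
    linarith

theorem IsDistantRun.norm_vel_and_estimate_le
    (H : IsDistantRun l₀ l₁ r t₀ τ Δt U M R u01 u2 w₀ ξ v) (hr : 0 < r) (hl₀ : 0 < l₀)
    (hl₁ : 0 < l₁) (hΔ : 0 < Δt) (hU : 0 ≤ U) (hR : 0 ≤ R) (k : ℕ)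
    (hk : sampleTime t₀ Δt k ≤ τ) :
    ‖v (sampleTime t₀ Δt k)‖ ≤ speedBound l₀ l₁ r t₀ U R (sampleTime t₀ Δt k) ∧
    ‖w2hat l₀ l₁ r t₀ Δt u01 u2 ξ v w₀ k‖ ≤
      l₀ * r + 3 * U + R + l₁ * speedBound l₀ l₁ r t₀ U R (sampleTime t₀ Δt k) := by
  have hlr : 0 < l₀ * r := by positivity
  induction k with
  | zero =>
    have h1 := le_speedBound (t₀ := t₀) hr hl₀ hl₁ hU hR le_rfl
    have h2 := H.vel_init
    have h3 := H.est_init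
    have h4 : 0 ≤ l₁ * speedBound l₀ l₁ r t₀ U R t₀ := mul_nonneg hl₁.le (by linarith)
    rw [sampleTime_zero, w2hat]
    constructor <;> linarith
  | succ k ih =>
    have hs := sampleTime_succ t₀ Δt k
    have hkτ : sampleTime t₀ Δt k ≤ τ := by linarith
    obtain ⟨iv, iw⟩ := ih hkτ
    refine ⟨H.norm_vel_le_step hr hl₀ hl₁ hΔ hU hR iv iw (by linarith) le_rfl hk, ?_⟩
    have g1 := H.norm_expectedAction_le hr hl₀ hl₁ hΔ hkτ
    have g2 := H.other_le _ (sampleTime_mem_Icc hΔ hkτ)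
    have g3 : ‖w2hat l₀ l₁ r t₀ Δt u01 u2 ξ v w₀ (k + 1)‖ ≤
        ‖u2 (sampleTime t₀ Δt k)‖ + ‖expectedAction l₀ l₁ r t₀ Δt u01 u2 ξ v w₀ k‖ :=
      norm_sub_le _ _
    have g4 := mul_le_mul_of_nonneg_left (speedBound_mono (l₀ := l₀) (t₀ := t₀) hr hl₀ hl₁ hU hR
      (show sampleTime t₀ Δt k ≤ sampleTime t₀ Δt (k + 1) by linarith)) hl₁.le
    have g5 := mul_le_mul_of_nonneg_left iv hl₁.le
    linarith

theorem IsDistantRun.norm_vel_le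
    (H : IsDistantRun l₀ l₁ r t₀ τ Δt U M R u01 u2 w₀ ξ v) (hr : 0 < r) (hl₀ : 0 < l₀)
    (hl₁ : 0 < l₁) (hΔ : 0 < Δt) (hU : 0 ≤ U) (hR : 0 ≤ R) {t : ℝ} (ht : t ∈ Icc t₀ τ) :
    ‖v t‖ ≤ speedBound l₀ l₁ r t₀ U R t := by
  obtain ⟨k, h1, h2⟩ := exists_sampleTime_le hΔ ht.1
  obtain ⟨hv, hw⟩ := H.norm_vel_and_estimate_le hr hl₀ hl₁ hΔ hU hR k (h1.trans ht.2)
  exact H.norm_vel_le_step hr hl₀ hl₁ hΔ hU hR hv hw h1 h2.le ht.2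

/-- A common bound `B` for all signals of a run, which also serves as a Lipschitz constant in
time. -/
structure SignalsBounded (l₀ l₁ r t₀ τ Δt B : ℝ) (u01 u2 ξ v : ℝ → Plane) (w₀ : Plane) :
    Prop where
  pos_le : ∀ t ∈ Icc t₀ τ, ‖ξ t‖ ≤ B
  vel_le : ∀ t ∈ Icc t₀ τ, ‖v t‖ ≤ B
  accel_le : ∀ k, sampleTime t₀ Δt k ≤ τ → ∀ t ∈ Icc t₀ τ,
    ‖heldAction l₀ l₁ r t₀ Δt u01 u2 ξ v w₀ k - u2 t‖ ≤ B
  expected_le : ∀ k, sampleTime t₀ Δt k ≤ τ →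
    ‖expectedAction l₀ l₁ r t₀ Δt u01 u2 ξ v w₀ k‖ ≤ B
  other_sub_init_le : ‖u2 t₀ - w₀‖ ≤ B
  other_lip : ∀ s ∈ Icc t₀ τ, ∀ t ∈ Icc t₀ τ, ‖u2 t - u2 s‖ ≤ B * ‖t - s‖

/-- The bound is uniform in the sampling time, in the run, and in the end time `τ ≤ T`. -/
theorem exists_signalsBounded (hr : 0 < r) (hl₀ : 0 < l₀) (hl₁ : 0 < l₁) (hU : 0 ≤ U)
    (hM : 0 ≤ M) (hR : 0 ≤ R) {T : ℝ} (hT : t₀ ≤ T) :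
    ∃ B : ℝ, 0 < B ∧ ∀ (τ Δt : ℝ) (u01 u2 ξ v : ℝ → Plane) (w₀ : Plane), t₀ ≤ τ → τ ≤ T →
      0 < Δt → IsDistantRun l₀ l₁ r t₀ τ Δt U M R u01 u2 w₀ ξ v →
      SignalsBounded l₀ l₁ r t₀ τ Δt B u01 u2 ξ v w₀ := by
  set V := speedBound l₀ l₁ r t₀ U R T with hV
  have hlr : 0 < l₀ * r := by positivity
  have hVge := le_speedBound hr hl₀ hl₁ hU hR hT
  rw [← hV] at hVge
  have hV0 : 0 < V := by linarith
  have hVT : 0 ≤ V * (T - t₀) := mul_nonneg hV0.le (by linarith)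
  have hlV : 0 ≤ l₁ * V := by positivity
  refine ⟨l₀ * r + 5 * U + 2 * R + M + V + l₁ * V + V * (T - t₀), by linarith, ?_⟩
  intro τ Δt u01 u2 ξ v w₀ hτ hτT hΔ H
  have hv : ∀ t ∈ Icc t₀ τ, ‖v t‖ ≤ V := fun t ht =>
    (H.norm_vel_le hr hl₀ hl₁ hΔ hU hR ht).trans
      (speedBound_mono hr hl₀ hl₁ hU hR (ht.2.trans hτT))
  have he : ∀ k, sampleTime t₀ Δt k ≤ τ →
      ‖expectedAction l₀ l₁ r t₀ Δt u01 u2 ξ v w₀ k‖ ≤ l₀ * r + 3 * U + R + l₁ * V := by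
    intro k hk
    obtain ⟨h1, h2⟩ := H.norm_vel_and_estimate_le hr hl₀ hl₁ hΔ hU hR k hk
    have h3 := H.norm_expectedAction_le hr hl₀ hl₁ hΔ hk
    have h4 := mul_le_mul_of_nonneg_left
      (speedBound_mono (t₀ := t₀) hr hl₀ hl₁ hU hR (hk.trans hτT)) hl₁.le
    have h5 := mul_le_mul_of_nonneg_left h1 hl₁.le
    linarith
  constructor
  · intro t ht
    have h1 : ‖ξ t - ξ t₀‖ ≤ V * (t - t₀) :=
      norm_image_sub_le_of_norm_deriv_right_le_segment (f' := v) H.continuousOn_pos H.deriv_pos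
        (fun s hs => hv s ⟨hs.1, hs.2.le⟩) t ht
    have h2 : V * (t - t₀) ≤ V * (T - t₀) :=
      mul_le_mul_of_nonneg_left (by linarith [ht.2]) hV0.le
    have h3 := norm_le_norm_add_norm_sub' (ξ t) (ξ t₀)
    have h4 := H.pos_init
    linarith
  · intro t ht
    have := hv t ht
    linarith
  · intro k hk t ht
    have h1 := norm_sub_le (heldAction l₀ l₁ r t₀ Δt u01 u2 ξ v w₀ k) (u2 t)
    have h2 := H.norm_heldAction_le hΔ hk
    have h3 := he k hk
    have h4 := H.other_le t ht
    linarith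
  · intro k hk
    have := he k hk
    linarith
  · have h1 := norm_sub_le (u2 t₀) w₀
    have h2 := H.other_le t₀ ⟨le_rfl, hτ⟩
    have h3 := H.est_init
    linarith
  · intro s hs t ht
    exact (H.other_lip s hs t ht).trans
      (mul_le_mul_of_nonneg_right (by linarith) (norm_nonneg _))

end Bounds

/-! ### The sampling error of the barrier inequality -/

section Sampling

variable {l₀ l₁ r t₀ τ Δt U M R B : ℝ} {u01 u2 ξ v : ℝ → Plane} {w₀ : Plane}

/-- The delayed value of `min 0 μ₁`: entry `k + 1` is `min 0 μ₁(k) = 2 b(k) u₁₂*(k)`. Entry `0`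
takes its value from the initial error of the disturbance estimate. -/
noncomputable def delayedDeficit (l₀ l₁ r t₀ Δt : ℝ) (u01 u2 ξ v : ℝ → Plane) (w₀ : Plane) :
    ℕ → ℝ
  | 0 => 2 * inner ℝ (bT (ξ t₀)) (u2 t₀ - w₀)
  | k + 1 => 2 * inner ℝ (bT (ξ (sampleTime t₀ Δt k)))
      (expectedAction l₀ l₁ r t₀ Δt u01 u2 ξ v w₀ k)

theorem abs_delayedDeficit_zero_le (S : SignalsBounded l₀ l₁ r t₀ τ Δt B u01 u2 ξ v w₀)
    (hτ : t₀ ≤ τ) (hB : 0 < B) :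
    |delayedDeficit l₀ l₁ r t₀ Δt u01 u2 ξ v w₀ 0| ≤ 4 * B ^ 2 := by
  have h1 := abs_real_inner_le_norm (bT (ξ t₀)) (u2 t₀ - w₀)
  rw [norm_bT] at h1
  have h2 := mul_le_mul (S.pos_le t₀ ⟨le_rfl, hτ⟩) S.other_sub_init_le (norm_nonneg _) hB.le
  rw [delayedDeficit, abs_mul, abs_of_pos two_pos]
  linarith

theorem abs_delayedDeficit_succ_le (S : SignalsBounded l₀ l₁ r t₀ τ Δt B u01 u2 ξ v w₀)
    (hΔ : 0 < Δt) (hB : 0 < B) {k : ℕ} (hk : sampleTime t₀ Δt k ≤ τ) :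
    |delayedDeficit l₀ l₁ r t₀ Δt u01 u2 ξ v w₀ (k + 1)| ≤ 4 * B ^ 2 := by
  have h1 := abs_real_inner_le_norm (bT (ξ (sampleTime t₀ Δt k)))
    (expectedAction l₀ l₁ r t₀ Δt u01 u2 ξ v w₀ k)
  rw [norm_bT] at h1
  have h2 := mul_le_mul (S.pos_le _ ⟨le_sampleTime hΔ k, hk⟩) (S.expected_le k hk)
    (norm_nonneg _) hB.le
  rw [delayedDeficit, abs_mul, abs_of_pos two_pos]
  linarith

theorem abs_delayedDeficit_le (S : SignalsBounded l₀ l₁ r t₀ τ Δt B u01 u2 ξ v w₀)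
    (hΔ : 0 < Δt) (hB : 0 < B) {k : ℕ} (hk : sampleTime t₀ Δt k ≤ τ) :
    |delayedDeficit l₀ l₁ r t₀ Δt u01 u2 ξ v w₀ k| ≤ 4 * B ^ 2 := by
  cases k with
  | zero => exact abs_delayedDeficit_zero_le S (by rwa [sampleTime_zero] at hk) hB
  | succ k => exact abs_delayedDeficit_succ_le S hΔ hB (by rw [sampleTime_succ] at hk; linarith)

/-- Between two times the position moves by at most `B` times the elapsed time. -/
theorem IsDistantRun.norm_pos_sub_le
    (H : IsDistantRun l₀ l₁ r t₀ τ Δt U M R u01 u2 w₀ ξ v)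
    (S : SignalsBounded l₀ l₁ r t₀ τ Δt B u01 u2 ξ v w₀) {s t : ℝ} (hs : t₀ ≤ s) (hst : s ≤ t)
    (ht : t ≤ τ) : ‖ξ t - ξ s‖ ≤ B * (t - s) :=
  norm_image_sub_le_of_norm_deriv_right_le_segment (f' := v)
    (H.continuousOn_pos.mono (Icc_subset_Icc hs ht))
    (fun x hx => H.deriv_pos x ⟨hs.trans hx.1, hx.2.trans_le ht⟩)
    (fun x hx => S.vel_le x ⟨hs.trans hx.1, hx.2.le.trans ht⟩) t ⟨hst, le_rfl⟩

theorem IsDistantRun.norm_vel_sub_le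
    (H : IsDistantRun l₀ l₁ r t₀ τ Δt U M R u01 u2 w₀ ξ v)
    (S : SignalsBounded l₀ l₁ r t₀ τ Δt B u01 u2 ξ v w₀) (hΔ : 0 < Δt) {k : ℕ} {t : ℝ}
    (h1 : sampleTime t₀ Δt k ≤ t) (h2 : t ≤ sampleTime t₀ Δt (k + 1)) (h3 : t ≤ τ) :
    ‖v t - v (sampleTime t₀ Δt k)‖ ≤ B * (t - sampleTime t₀ Δt k) :=
  norm_image_sub_le_of_norm_deriv_right_le_segment
    (f' := fun s => heldAction l₀ l₁ r t₀ Δt u01 u2 ξ v w₀ k - u2 s)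
    (H.continuousOn_vel.mono (Icc_subset_Icc (le_sampleTime hΔ k) h3))
    (fun _ hx => H.hasDerivWithinAt_vel hΔ hx.1 (hx.2.trans_le h2) (hx.2.trans_le h3))
    (fun x hx => S.accel_le k (h1.trans h3) x
      ⟨(le_sampleTime hΔ k).trans hx.1, hx.2.le.trans h3⟩) t ⟨h1, le_rfl⟩

/-- One sample of delay: `2 b (u₂ - ŵ₂)` at `t_k` agrees with `min 0 μ₁` at `t_{k-1}` up to
`O(Δt)`, because `u₂` and `b` are Lipschitz. -/
theorem IsDistantRun.abs_estimate_error_sub_delayedDeficit_le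
    (H : IsDistantRun l₀ l₁ r t₀ τ Δt U M R u01 u2 w₀ ξ v)
    (S : SignalsBounded l₀ l₁ r t₀ τ Δt B u01 u2 ξ v w₀) (hΔ : 0 < Δt) (hB : 0 < B) {k : ℕ}
    (hk : sampleTime t₀ Δt k ≤ τ) :
    |2 * inner ℝ (bT (ξ (sampleTime t₀ Δt k)))
        (u2 (sampleTime t₀ Δt k) - w2hat l₀ l₁ r t₀ Δt u01 u2 ξ v w₀ k) -
      delayedDeficit l₀ l₁ r t₀ Δt u01 u2 ξ v w₀ k| ≤ 8 * B ^ 2 * Δt := by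
  cases k with
  | zero =>
    rw [sampleTime_zero, w2hat, delayedDeficit, sub_self, abs_zero]
    positivity
  | succ k =>
    have hs := sampleTime_succ t₀ Δt k
    set s := sampleTime t₀ Δt k with hsdef
    set t := sampleTime t₀ Δt (k + 1) with htdef
    have hs0 : t₀ ≤ s := le_sampleTime hΔ k
    have hsτ : s ≤ τ := by linarith
    set e := expectedAction l₀ l₁ r t₀ Δt u01 u2 ξ v w₀ k with he
    have hw : w2hat l₀ l₁ r t₀ Δt u01 u2 ξ v w₀ (k + 1) = u2 s - e := rfl
    have hd : delayedDeficit l₀ l₁ r t₀ Δt u01 u2 ξ v w₀ (k + 1) = 2 * inner ℝ (bT (ξ s)) e :=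
      rfl
    have hts : t - s = Δt := by linarith
    have b1 : ‖ξ t - ξ s‖ ≤ B * Δt := by
      rw [← hts]; exact H.norm_pos_sub_le S hs0 (by linarith) hk
    have b2 : ‖u2 t - u2 s‖ ≤ B * Δt := by
      have := S.other_lip s ⟨hs0, hsτ⟩ t ⟨by linarith, hk⟩
      rwa [hts, Real.norm_of_nonneg hΔ.le] at this
    have b3 := S.pos_le t ⟨by linarith, hk⟩
    have b4 : ‖e‖ ≤ B := S.expected_le k hsτ
    have c1 := (abs_real_inner_le_norm (ξ t - ξ s) e).trans
      (mul_le_mul b1 b4 (norm_nonneg _) (by positivity))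
    have c2 := (abs_real_inner_le_norm (ξ t) (u2 t - u2 s)).trans
      (mul_le_mul b3 b2 (norm_nonneg _) hB.le)
    have e1 : 2 * inner ℝ (bT (ξ t)) (u2 t - (u2 s - e)) - 2 * inner ℝ (bT (ξ s)) e =
        4 * inner ℝ (ξ t - ξ s) e + 4 * inner ℝ (ξ t) (u2 t - u2 s) := by
      simp only [bT, inner_smul_left, inner_sub_left, inner_sub_right, conj_trivial]
      ring
    rw [hw, hd, e1]
    refine (abs_add_le _ _).trans ?_
    rw [abs_mul, abs_mul, abs_of_pos four_pos]
    linarith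

/-- The second-order barrier expression along a run, between samples. -/
theorem IsDistantRun.barrier_expr_ge
    (H : IsDistantRun l₀ l₁ r t₀ τ Δt U M R u01 u2 w₀ ξ v)
    (S : SignalsBounded l₀ l₁ r t₀ τ Δt B u01 u2 ξ v w₀) (hr : 0 < r) (hl₀ : 0 < l₀)
    (hl₁ : 0 < l₁) (hΔ : 0 < Δt) (hB : 0 < B) {k : ℕ} {t : ℝ}
    (h1 : sampleTime t₀ Δt k ≤ t) (h2 : t ≤ sampleTime t₀ Δt (k + 1)) (h3 : t ≤ τ) :
    (delayedDeficit l₀ l₁ r t₀ Δt u01 u2 ξ v w₀ (k + 1) -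
        delayedDeficit l₀ l₁ r t₀ Δt u01 u2 ξ v w₀ k) / 2 -
        (12 + 4 * l₁ + 2 * l₀) * B ^ 2 * Δt ≤
      a l₀ l₁ r (ξ t) (v t) +
        inner ℝ (bT (ξ t)) (heldAction l₀ l₁ r t₀ Δt u01 u2 ξ v w₀ k - u2 t) := by
  have hkτ := h1.trans h3
  have hsucc := sampleTime_succ t₀ Δt k
  have hd := H.abs_estimate_error_sub_delayedDeficit_le S hΔ hB hkτ
  have hx := H.norm_pos_sub_le S (le_sampleTime hΔ k) h1 h3
  have hv := H.norm_vel_sub_le S hΔ h1 h2 h3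
  have hd1 : delayedDeficit l₀ l₁ r t₀ Δt u01 u2 ξ v w₀ (k + 1) =
    2 * inner ℝ (bT (ξ (sampleTime t₀ Δt k)))
      (expectedAction l₀ l₁ r t₀ Δt u01 u2 ξ v w₀ k) := rfl
  set s := sampleTime t₀ Δt k with hs
  have hsI : s ∈ Icc t₀ τ := ⟨le_sampleTime hΔ k, hkτ⟩
  have htI : t ∈ Icc t₀ τ := ⟨hsI.1.trans h1, h3⟩
  have hξ0 : ξ s ≠ 0 := by
    have := H.distant s hsI
    exact norm_pos_iff.mp (by linarith)
  have hsample := half_sub_le_barrier_expr l₀ l₁ r (v s) (u01 s) (u2 s)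
    (w2hat l₀ l₁ r t₀ Δt u01 u2 ξ v w₀ k) hξ0
  change (2 * inner ℝ (bT (ξ s)) (expectedAction l₀ l₁ r t₀ Δt u01 u2 ξ v w₀ k) - _) / 2 ≤
    _ + inner ℝ (bT (ξ s)) (heldAction l₀ l₁ r t₀ Δt u01 u2 ξ v w₀ k - u2 s) at hsample
  set c := heldAction l₀ l₁ r t₀ Δt u01 u2 ξ v w₀ k with hc
  have hBts : B * (t - s) ≤ B * Δt := mul_le_mul_of_nonneg_left (by linarith) hB.le
  have hx' := hx.trans hBts
  have hv' := hv.trans hBts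
  have hu' : ‖(c - u2 t) - (c - u2 s)‖ ≤ B * Δt := by
    have := S.other_lip s hsI t htI
    rw [Real.norm_of_nonneg (by linarith)] at this
    rw [sub_sub_sub_cancel_left, norm_sub_rev]
    exact this.trans hBts
  -- each scalar product that occurs changes by at most `2 B² Δt` since the last sample
  have key : ∀ x y x' y' : Plane, ‖x - x'‖ ≤ B * Δt → ‖y - y'‖ ≤ B * Δt → ‖y‖ ≤ B → ‖x'‖ ≤ B →
      |inner ℝ x y - inner ℝ x' y'| ≤ 2 * B ^ 2 * Δt := by
    intro x y x' y' p1 p2 p3 p4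
    have q1 := mul_le_mul p1 p3 (norm_nonneg _) (by positivity)
    have q2 := mul_le_mul p4 p2 (norm_nonneg _) hB.le
    have := abs_inner_sub_inner_le x y x' y'
    linarith
  have k1 := (abs_le.mp (key _ _ _ _ hv' hv' (S.vel_le t htI) (S.vel_le s hsI))).1
  have k2 := (abs_le.mp (key _ _ _ _ hx' hv' (S.vel_le t htI) (S.pos_le s hsI))).1
  have k3 := (abs_le.mp (key _ _ _ _ hx' hx' (S.pos_le t htI) (S.pos_le s hsI))).1
  have k4 := (abs_le.mp (key _ _ _ _ hx' hu' (S.accel_le k hkτ t htI) (S.pos_le s hsI))).1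
  have k2' := mul_le_mul_of_nonneg_left k2 hl₁.le
  have k3' := mul_le_mul_of_nonneg_left k3 hl₀.le
  have hd' := (abs_le.mp hd).2
  have e1 : ∀ x y : Plane, inner ℝ (bT x) y = 2 * inner ℝ x y := fun x y => by
    simp [bT, inner_smul_left]
  rw [hd1]
  rw [e1, e1, e1] at hsample
  rw [e1, e1]
  rw [e1] at hd'
  simp only [a] at hsample ⊢
  linarith

/-! ### The two first-order barriers -/

/-- Piecewise linear interpolation of the accumulated deficits on the holding interval of index
`k`. It is `O(Δt)`, its slope is half of the difference of consecutive deficits, and its values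
on neighbouring intervals match at the sampling instants. -/
noncomputable def corrector (t₀ Δt : ℝ) (p : ℕ → ℝ) (k : ℕ) (t : ℝ) : ℝ :=
  ((t - sampleTime t₀ Δt k) * p (k + 1) + (sampleTime t₀ Δt (k + 1) - t) * p k) / 2

theorem abs_corrector_le {p : ℕ → ℝ} {k : ℕ} {t C : ℝ} (h1 : sampleTime t₀ Δt k ≤ t)
    (h2 : t ≤ sampleTime t₀ Δt (k + 1)) (hp : |p k| ≤ C) (hp' : |p (k + 1)| ≤ C) :
    |corrector t₀ Δt p k t| ≤ C * Δt / 2 := by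
  have hs := sampleTime_succ t₀ Δt k
  rw [abs_le] at hp hp'
  have a1 : 0 ≤ t - sampleTime t₀ Δt k := by linarith
  have a2 : 0 ≤ sampleTime t₀ Δt (k + 1) - t := by linarith
  have e : C * Δt = (t - sampleTime t₀ Δt k) * C + (sampleTime t₀ Δt (k + 1) - t) * C := by
    rw [hs]; ring
  rw [corrector, abs_le]
  constructor
  · have := mul_le_mul_of_nonneg_left hp'.1 a1
    have := mul_le_mul_of_nonneg_left hp.1 a2
    linarith
  · have := mul_le_mul_of_nonneg_left hp'.2 a1
    have := mul_le_mul_of_nonneg_left hp.2 a2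
    linarith

theorem hasDerivAt_corrector (p : ℕ → ℝ) (k : ℕ) (t : ℝ) :
    HasDerivAt (corrector t₀ Δt p k) ((p (k + 1) - p k) / 2) t := by
  have h1 := ((hasDerivAt_id t).sub_const (sampleTime t₀ Δt k)).mul_const (p (k + 1))
  have h2 := ((hasDerivAt_id t).const_sub (sampleTime t₀ Δt (k + 1))).mul_const (p k)
  refine ((h1.add h2).div_const 2).congr_deriv ?_
  ring

theorem IsDistantRun.hasDerivWithinAt_h (H : IsDistantRun l₀ l₁ r t₀ τ Δt U M R u01 u2 w₀ ξ v)
    {t : ℝ} (ht : t ∈ Ico t₀ τ) :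
    HasDerivWithinAt (fun t => h r (ξ t)) (hdot (ξ t) (v t)) (Ici t) t := by
  have hx := H.deriv_pos t ht
  have := (hx.inner ℝ hx).sub_const (r ^ 2)
  refine this.congr_deriv ?_
  rw [hdot, real_inner_comm (v t) (ξ t)]
  ring

theorem IsDistantRun.hasDerivWithinAt_hdot
    (H : IsDistantRun l₀ l₁ r t₀ τ Δt U M R u01 u2 w₀ ξ v) (hΔ : 0 < Δt) {k : ℕ} {t : ℝ}
    (h1 : sampleTime t₀ Δt k ≤ t) (h2 : t < sampleTime t₀ Δt (k + 1)) (h3 : t < τ) :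
    HasDerivWithinAt (fun t => hdot (ξ t) (v t))
      (a l₀ l₁ r (ξ t) (v t) +
        inner ℝ (bT (ξ t)) (heldAction l₀ l₁ r t₀ Δt u01 u2 ξ v w₀ k - u2 t) -
        l₁ * hdot (ξ t) (v t) - l₀ * h r (ξ t)) (Ici t) t := by
  have hx := H.deriv_pos t ⟨(le_sampleTime hΔ k).trans h1, h3⟩
  have hv := H.hasDerivWithinAt_vel hΔ h1 h2 h3
  have := (hx.inner ℝ hv).const_mul 2
  refine this.congr_deriv ?_
  simp only [a, hdot, h, bT, inner_smul_left, conj_trivial]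
  ring

theorem IsDistantRun.continuousOn_h (H : IsDistantRun l₀ l₁ r t₀ τ Δt U M R u01 u2 w₀ ξ v) :
    ContinuousOn (fun t => h r (ξ t)) (Icc t₀ τ) :=
  (H.continuousOn_pos.inner H.continuousOn_pos).sub continuousOn_const

theorem IsDistantRun.continuousOn_hdot (H : IsDistantRun l₀ l₁ r t₀ τ Δt U M R u01 u2 w₀ ξ v) :
    ContinuousOn (fun t => hdot (ξ t) (v t)) (Icc t₀ τ) :=
  continuousOn_const.mul (H.continuousOn_pos.inner H.continuousOn_vel)

/-- The barrier level, divided by `-Δt`, for `hdot - root * h` minus the corrector. -/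
noncomputable def innerLevel (l₀ l₁ root B : ℝ) : ℝ :=
  2 * B ^ 2 + ((12 + 4 * l₁ + 2 * l₀) * B ^ 2 + 1) / (l₁ + root)

theorem IsDistantRun.innerBarrier_step
    (H : IsDistantRun l₀ l₁ r t₀ τ Δt U M R u01 u2 w₀ ξ v)
    (S : SignalsBounded l₀ l₁ r t₀ τ Δt B u01 u2 ξ v w₀) (hr : 0 < r) (hl₀ : 0 < l₀)
    (hl₁ : 0 < l₁) (hΔ : 0 < Δt) (hB : 0 < B) {root : ℝ}
    (hroot : root ^ 2 + l₁ * root + l₀ = 0) {k : ℕ}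
    (hk : -(innerLevel l₀ l₁ root B * Δt) ≤
      hdot (ξ (sampleTime t₀ Δt k)) (v (sampleTime t₀ Δt k)) -
        root * h r (ξ (sampleTime t₀ Δt k)) -
        corrector t₀ Δt (delayedDeficit l₀ l₁ r t₀ Δt u01 u2 ξ v w₀) k (sampleTime t₀ Δt k))
    {t : ℝ} (h1 : sampleTime t₀ Δt k ≤ t) (h2 : t ≤ sampleTime t₀ Δt (k + 1)) (h3 : t ≤ τ) :
    -(innerLevel l₀ l₁ root B * Δt) ≤ hdot (ξ t) (v t) - root * h r (ξ t) -
      corrector t₀ Δt (delayedDeficit l₀ l₁ r t₀ Δt u01 u2 ξ v w₀) k t := by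
  obtain ⟨-, hneg⟩ := roots_neg hl₀ hl₁ hroot
  set p := delayedDeficit l₀ l₁ r t₀ Δt u01 u2 ξ v w₀ with hp
  have hk0 := le_sampleTime (t₀ := t₀) hΔ k
  have hkτ := h1.trans h3
  have hsub : Icc (sampleTime t₀ Δt k) t ⊆ Icc t₀ τ := Icc_subset_Icc hk0 h3
  refine le_of_deriv_pos_at_barrier
    (f := fun t => hdot (ξ t) (v t) - root * h r (ξ t) - corrector t₀ Δt p k t)
    (f' := fun t => a l₀ l₁ r (ξ t) (v t) +
        inner ℝ (bT (ξ t)) (heldAction l₀ l₁ r t₀ Δt u01 u2 ξ v w₀ k - u2 t) -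
        l₁ * hdot (ξ t) (v t) - l₀ * h r (ξ t) - root * hdot (ξ t) (v t) -
        (p (k + 1) - p k) / 2)
    (s := sampleTime t₀ Δt k) (e := t) ?_ ?_ hk ?_ t ⟨h1, le_rfl⟩
  · exact ((H.continuousOn_hdot.mono hsub).sub
      (continuousOn_const.mul (H.continuousOn_h.mono hsub))).sub
      (fun x _ => (hasDerivAt_corrector p k x).continuousAt.continuousWithinAt)
  · intro s hs
    exact ((H.hasDerivWithinAt_hdot hΔ hs.1 (hs.2.trans_le h2) (hs.2.trans_le h3)).sub
      ((H.hasDerivWithinAt_h ⟨hk0.trans hs.1, hs.2.trans_le h3⟩).const_mul root)).sub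
      (hasDerivAt_corrector p k s).hasDerivWithinAt
  · intro s hs hcontact
    have hs2 := hs.2.le.trans h2
    have g1 := H.barrier_expr_ge S hr hl₀ hl₁ hΔ hB hs.1 hs2 (hs.2.le.trans h3)
    have g2 := (abs_le.mp (abs_corrector_le hs.1 hs2 (abs_delayedDeficit_le S hΔ hB hkτ)
      (abs_delayedDeficit_succ_le S hΔ hB hkτ))).2
    rw [← hp] at g1 g2
    have hsum : 0 < l₁ + root := by linarith
    have hc : (l₁ + root) * (innerLevel l₀ l₁ root B - 2 * B ^ 2) =
        (12 + 4 * l₁ + 2 * l₀) * B ^ 2 + 1 := by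
      rw [innerLevel]; field_simp; ring
    have hc' := congrArg (· * Δt) hc
    have g3 := mul_le_mul_of_nonneg_left g2 hsum.le
    -- factor `s² + l₁ s + l₀` through its second root `-(l₁ + root)`
    have e1 : -(l₁ * hdot (ξ s) (v s)) - l₀ * h r (ξ s) - root * hdot (ξ s) (v s) =
        -(l₁ + root) * (hdot (ξ s) (v s) - root * h r (ξ s)) := by
      linear_combination -h r (ξ s) * hroot
    have e2 : hdot (ξ s) (v s) - root * h r (ξ s) =
        -(innerLevel l₀ l₁ root B * Δt) + corrector t₀ Δt p k s := by
      linarith [hcontact]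
    rw [e2] at e1
    linarith

theorem IsDistantRun.innerBarrier
    (H : IsDistantRun l₀ l₁ r t₀ τ Δt U M R u01 u2 w₀ ξ v)
    (S : SignalsBounded l₀ l₁ r t₀ τ Δt B u01 u2 ξ v w₀) (hr : 0 < r) (hl₀ : 0 < l₀)
    (hl₁ : 0 < l₁) (hΔ : 0 < Δt) (hB : 0 < B) {root : ℝ}
    (hroot : root ^ 2 + l₁ * root + l₀ = 0) (hinit : (ξ t₀, v t₀) ∈ admissible r root) (k : ℕ)
    (hk : sampleTime t₀ Δt k ≤ τ) :
    -(innerLevel l₀ l₁ root B * Δt) ≤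
      hdot (ξ (sampleTime t₀ Δt k)) (v (sampleTime t₀ Δt k)) -
        root * h r (ξ (sampleTime t₀ Δt k)) -
        corrector t₀ Δt (delayedDeficit l₀ l₁ r t₀ Δt u01 u2 ξ v w₀) k (sampleTime t₀ Δt k) := by
  obtain ⟨hneg, hneg'⟩ := roots_neg hl₀ hl₁ hroot
  induction k with
  | zero =>
    have hsum : 0 < l₁ + root := by linarith
    have g1 := (abs_le.mp (abs_corrector_le (le_refl (sampleTime t₀ Δt 0))
      (by rw [sampleTime_succ]; linarith) (abs_delayedDeficit_le S hΔ hB hk)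
      (abs_delayedDeficit_succ_le S hΔ hB hk))).2
    have g2 : hdot (ξ t₀) (v t₀) / root ≤ h r (ξ t₀) := hinit.2
    rw [div_le_iff_of_neg hneg] at g2
    have g3 : 2 * B ^ 2 * Δt ≤ innerLevel l₀ l₁ root B * Δt := by
      refine mul_le_mul_of_nonneg_right ?_ hΔ.le
      rw [innerLevel]
      have : 0 ≤ ((12 + 4 * l₁ + 2 * l₀) * B ^ 2 + 1) / (l₁ + root) := by positivity
      linarith
    rw [sampleTime_zero] at g1 ⊢
    linarith
  | succ k ih =>
    have hs := sampleTime_succ t₀ Δt k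
    have := H.innerBarrier_step S hr hl₀ hl₁ hΔ hB hroot (ih (by linarith))
      (show sampleTime t₀ Δt k ≤ sampleTime t₀ Δt (k + 1) by linarith) le_rfl hk
    refine this.trans_eq ?_
    simp only [corrector, sampleTime_succ]
    ring

/-- The constant `κ` in the estimate `h ≥ -κ Δt`. -/
noncomputable def safetyLevel (l₀ l₁ root B : ℝ) : ℝ :=
  (innerLevel l₀ l₁ root B + 2 * B ^ 2 + 1) / -root

theorem safetyLevel_pos (hl₀ : 0 < l₀) (hl₁ : 0 < l₁) {root : ℝ}
    (hroot : root ^ 2 + l₁ * root + l₀ = 0) : 0 < safetyLevel l₀ l₁ root B := by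
  obtain ⟨hneg, hneg'⟩ := roots_neg hl₀ hl₁ hroot
  have h1 : 0 < l₁ + root := by linarith
  have h2 : 0 < -root := by linarith
  unfold safetyLevel innerLevel
  positivity

theorem IsDistantRun.neg_safetyLevel_le_h
    (H : IsDistantRun l₀ l₁ r t₀ τ Δt U M R u01 u2 w₀ ξ v)
    (S : SignalsBounded l₀ l₁ r t₀ τ Δt B u01 u2 ξ v w₀) (hr : 0 < r) (hl₀ : 0 < l₀)
    (hl₁ : 0 < l₁) (hΔ : 0 < Δt) (hB : 0 < B) {root : ℝ}
    (hroot : root ^ 2 + l₁ * root + l₀ = 0) (hinit : (ξ t₀, v t₀) ∈ admissible r root) :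
    ∀ t ∈ Icc t₀ τ, -(safetyLevel l₀ l₁ root B * Δt) ≤ h r (ξ t) := by
  obtain ⟨hneg, -⟩ := roots_neg hl₀ hl₁ hroot
  have hκ := safetyLevel_pos (B := B) hl₀ hl₁ hroot
  refine le_of_deriv_pos_at_barrier (f' := fun t => hdot (ξ t) (v t)) H.continuousOn_h
    (fun t ht => H.hasDerivWithinAt_h ht) ?_ ?_
  · have : 0 ≤ h r (ξ t₀) := hinit.1
    have := mul_pos hκ hΔ
    linarith
  · intro t ht hcontact
    obtain ⟨k, h1, h2⟩ := exists_sampleTime_le hΔ ht.1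
    have hkτ := h1.trans ht.2.le
    have g1 := H.innerBarrier_step S hr hl₀ hl₁ hΔ hB hroot
      (H.innerBarrier S hr hl₀ hl₁ hΔ hB hroot hinit k hkτ) h1 h2.le ht.2.le
    have g2 := (abs_le.mp (abs_corrector_le h1 h2.le (abs_delayedDeficit_le S hΔ hB hkτ)
      (abs_delayedDeficit_succ_le S hΔ hB hkτ))).1
    have e1 : root * -(safetyLevel l₀ l₁ root B * Δt) =
        (innerLevel l₀ l₁ root B + 2 * B ^ 2 + 1) * Δt := by
      have : root ≠ 0 := hneg.ne
      rw [safetyLevel]; field_simp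
    rw [hcontact, e1] at g1
    linarith

end Sampling

/-! ### Removing the assumption on the distance -/

theorem sq_norm_eq_h_add (r : ℝ) (ξ : Plane) : ‖ξ‖ ^ 2 = h r ξ + r ^ 2 := by
  rw [h, real_inner_self_eq_norm_sq]; ring

end PCCA

theorem proposition1
    -- safety distance, barrier gains (both roots of `s² + l₁ s + l₀` real negative), chosen root
    (r l₀ l₁ root : ℝ) (hr : 0 < r) (hl₀ : 0 < l₀) (hl₁ : 0 < l₁) (hdisc : 4 * l₀ ≤ l₁ ^ 2)
    (hroot : root ^ 2 + l₁ * root + l₀ = 0)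
    -- bounds on the base actions, on the derivative of `u₀₂`, and on the initial data
    (U M R : ℝ) (t₀ T : ℝ) (hT : t₀ < T) :
    ∃ Δtstar > (0 : ℝ), ∃ κ > (0 : ℝ), ∀ Δt : ℝ, 0 < Δt → Δt < Δtstar →
      ∀ (u01 u02 : ℝ → PCCA.Plane) (w₀ : PCCA.Plane) (ξ v : ℝ → PCCA.Plane),
        (∀ t ∈ Set.Icc t₀ T, ‖u01 t‖ ≤ U) →
        (∀ t ∈ Set.Icc t₀ T, ‖u02 t‖ ≤ U) →
        DifferentiableOn ℝ u02 (Set.Icc t₀ T) →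
        (∀ t ∈ Set.Icc t₀ T, ‖derivWithin u02 (Set.Icc t₀ T) t‖ ≤ M) →
        (ξ t₀, v t₀) ∈ PCCA.admissible r root →
        ‖ξ t₀‖ ≤ R → ‖v t₀‖ ≤ R → ‖w₀‖ ≤ R →
        PCCA.IsClosedLoopSolution l₀ l₁ r t₀ T Δt u01 u02 w₀ ξ v →
        ∀ t ∈ Set.Icc t₀ T, -(κ * Δt) ≤ PCCA.h r (ξ t) := by

  have hU : ∀ x : PCCA.Plane, ‖x‖ ≤ U → ‖x‖ ≤ |U| := fun _ hx => hx.trans (le_abs_self U)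
  have hR : ∀ x : PCCA.Plane, ‖x‖ ≤ R → ‖x‖ ≤ |R| := fun _ hx => hx.trans (le_abs_self R)
  obtain ⟨B, hB, hbound⟩ := PCCA.exists_signalsBounded (t₀ := t₀) hr hl₀ hl₁ (abs_nonneg U)
    (abs_nonneg M) (abs_nonneg R) hT.le
  have hκ := PCCA.safetyLevel_pos (B := B) hl₀ hl₁ hroot
  refine ⟨r ^ 2 / (2 * PCCA.safetyLevel l₀ l₁ root B), by positivity,
    PCCA.safetyLevel l₀ l₁ root B, hκ, ?_⟩
  intro Δt hΔ hΔs u01 u02 w₀ ξ v hu01 hu02 hdiff hderiv hinit hξ hv hw hsol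
  -- as long as the distance stays above `r / 2`, the safety estimate holds
  have hmain : ∀ τ ∈ Set.Icc t₀ T, (∀ t ∈ Set.Icc t₀ τ, r / 2 ≤ ‖ξ t‖) →
      ∀ t ∈ Set.Icc t₀ τ, -(PCCA.safetyLevel l₀ l₁ root B * Δt) ≤ PCCA.h r (ξ t) := by
    intro τ hτ hfar
    have hsub : Set.Icc t₀ τ ⊆ Set.Icc t₀ T := Set.Icc_subset_Icc le_rfl hτ.2
    have hsub' : Set.Ico t₀ τ ⊆ Set.Ico t₀ T := Set.Ico_subset_Ico le_rfl hτ.2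
    have H : PCCA.IsDistantRun l₀ l₁ r t₀ τ Δt |U| |M| |R| u01 u02 w₀ ξ v :=
      { continuousOn_pos := hsol.continuousOn_pos.mono hsub
        continuousOn_vel := hsol.continuousOn_vel.mono hsub
        deriv_pos := fun t ht => hsol.deriv_pos t (hsub' ht)
        deriv_vel := fun t ht => hsol.deriv_vel t (hsub' ht)
        base_le := fun t ht => hU _ (hu01 t (hsub ht))
        other_le := fun t ht => hU _ (hu02 t (hsub ht))
        other_lip := fun s hs t ht =>
          (convex_Icc t₀ T).norm_image_sub_le_of_norm_derivWithin_le hdiff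
            (fun x hx => (hderiv x hx).trans (le_abs_self M)) (hsub hs) (hsub ht)
        pos_init := hR _ hξ
        vel_init := hR _ hv
        est_init := hR _ hw
        distant := hfar }
    exact H.neg_safetyLevel_le_h (hbound τ Δt u01 u02 ξ v w₀ hτ.1 hτ.2 hΔ H) hr hl₀ hl₁ hΔ hB
      hroot hinit
  refine hmain T ⟨hT.le, le_rfl⟩ ?_
  by_contra! hne
  obtain ⟨t₁, ht₁, hlt⟩ := hne
  have hinit0 : r / 2 ≤ ‖ξ t₀‖ := by
    have h1 : 0 ≤ PCCA.h r (ξ t₀) := hinit.1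
    have h2 := PCCA.sq_norm_eq_h_add r (ξ t₀)
    exact le_of_sq_le_sq (by nlinarith) (norm_nonneg _)
  -- the first time at which the distance is at most `r / 2`; there it equals `r / 2`
  obtain ⟨τ, ⟨hτI, hτle⟩, hleast⟩ :
      ∃ τ, IsLeast (Set.Icc t₀ T ∩ (fun t => ‖ξ t‖) ⁻¹' Set.Iic (r / 2)) τ :=
    (isCompact_Icc.of_isClosed_subset
      (hsol.continuousOn_pos.norm.preimage_isClosed_of_isClosed isClosed_Icc isClosed_Iic)
      Set.inter_subset_left).exists_isLeast ⟨t₁, ht₁, hlt.le⟩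
  obtain ⟨c, hc, hceq⟩ := intermediate_value_Icc' hτI.1
    (hsol.continuousOn_pos.norm.mono (Set.Icc_subset_Icc le_rfl hτI.2)) ⟨hτle, hinit0⟩
  have hcτ : c = τ :=
    le_antisymm hc.2 (hleast ⟨⟨hc.1, hc.2.trans hτI.2⟩, hceq.le⟩)
  subst hcτ
  have hfar : ∀ t ∈ Set.Icc t₀ c, r / 2 ≤ ‖ξ t‖ := by
    intro t ht
    by_contra! hcon
    have : t = c := le_antisymm ht.2 (hleast ⟨⟨ht.1, ht.2.trans hτI.2⟩, hcon.le⟩)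
    subst this
    exact hcon.ne hceq
  have h1 := hmain c hτI hfar c ⟨hτI.1, le_rfl⟩
  have h2 := PCCA.sq_norm_eq_h_add r (ξ c)
  have h3 : ‖ξ c‖ = r / 2 := hceq
  rw [lt_div_iff₀ (by positivity)] at hΔs
  rw [h3] at h2
  nlinarith
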